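/- Let $Q,A,B\in\mathbb{R}^{N\times N}$ with $Q$ symmetric positive definite and $B$ nonsingular, let $b\in\mathbb{R}^N$, $c\in\mathbb{R}$, and let $\phi(x)=\tfrac12 x^\top Qx+b^\top x+c$, with minimizer $x^*$. For $\varepsilon>0$ consider the closed-loop system with state $(x,z)\in\mathbb{R}^N\times\mathbb{R}^N$ $$\dot x=-k\left(\frac{\nabla\phi(z)}{|\nabla\phi(z)|^{\xi_1}}+\frac{\nabla\phi(z)}{|\nabla\phi(z)|^{\xi_2}}\right),\qquad \varepsilon\dot z=Az+Bu,$$ $$u=-B^{-1}Ax+B^{-1}\left(-\nu\frac{z-x}{|z-x|^{\xi_1}}-\nu\frac{z-x}{|z-x|^{\xi_2}}\right),$$ where $v/|v|^{\xi}:=0$ for $v=0$. Suppose that $k>0$, $\xi_1\in(0,1)$, $\xi_2<0$ and $\nu>\overline\sigma(QA)/\underline\lambda(Q)$, where $\overline\sigma$ denotes the largest singular value and $\underline\lambda$ the smallest eigenvalue. Then there exists $\varepsilon^*>0$ such that for all $\varepsilon\in(0,\varepsilon^*)$ the origin of the system written in the coordinates $(x-x^*,z-x^*)$ is globally fixed-time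 stable. In particular, if $b=0$ (so that $x^*=0$), then the origin of the system itself is globally fixed-time stable. Here the origin is called globally fixed-time stable for $\dot\zeta=f(\zeta)$ if every initial state admits a solution defined for all $t\ge0$, and there exist a generalized class $\mathcal{KL}$ function $\beta$, a continuous function $T\ge 0$ of the initial state and a constant $T^*>0$ such that every solution satisfies $|\zeta(t)|\le\beta(|\zeta(0)|,t)$ at all times $t\ge0$ at which it is defined, $\beta(|\zeta_0|,t)=0$ for all $\zeta_0$ and all $t\ge T(\zeta_0)$, and $T(\zeta_0)\le T^*$ for all $\zeta_0$. A function $\beta:\mathbb{R}_{\ge0}\times\mathbb{R}_{\ge0}\to\mathbb{R}_{\ge0}$ is of generalized class $\mathcal{KL}$ if for each $r$ the function $\beta(r,\cdot)$ is non-increasing with limit $0$, and for each $t$ the function $\beta(\cdot,t)$ is continuous, vanishes at $0$, and is either identically zero or non-decreasing, unbounded, and strictly increasing wherever it is positive. -/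

import Mathlib

namespace FixedTime

noncomputable section

/-- Generalized class `𝒦∞` functions (only the values on `[0, ∞)` matter): continuous, zero at
zero, and either unbounded and strictly increasing wherever they are positive, or identically zero.
An (ordinary) class `𝒦∞` function is one which is moreover positive on `(0, ∞)`. -/
structure IsGenKInfty (α : ℝ → ℝ) : Prop where
  continuousOn : ContinuousOn α (Set.Ici 0)
  map_zero : α 0 = 0
  monotoneOn : MonotoneOn α (Set.Ici 0)
  strict : ∀ r s, 0 ≤ r → r < s → 0 < α s → α r < α s
  unbounded : (∀ r, 0 ≤ r → α r = 0) ∨ Filter.Tendsto α Filter.atTop Filter.atTop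

/-- Generalized class `𝒦ℒ` functions: generalized class `𝒦∞` in the first argument, and
non-increasing with limit zero in the second one. -/
structure IsGenKL (β : ℝ → ℝ → ℝ) : Prop where
  genKInfty : ∀ t, 0 ≤ t → IsGenKInfty fun r => β r t
  antitoneOn : ∀ r, 0 ≤ r → AntitoneOn (β r) (Set.Ici 0)
  tendsto_zero : ∀ r, 0 ≤ r → Filter.Tendsto (β r) Filter.atTop (nhds 0)

section Stability

variable {F : Type*} [NormedAddCommGroup F] [NormedSpace ℝ F]

/-- `ζ` is a (classical) solution of `ζ' = f(ζ)` on the time interval `I`. -/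
def IsSolutionOn (f : F → F) (ζ : ℝ → F) (I : Set ℝ) : Prop :=
  ∀ t ∈ I, HasDerivWithinAt ζ (f (ζ t)) I t

/-- The system `ζ' = f(ζ)` renders the origin globally fixed-time stable.

The estimate is imposed on every solution on every interval `[0, τ)` with `0 < τ < ∞`. This covers
solutions on `[0, ∞)` (restrict them), and it excludes finite escape times. -/
def GloballyFixedTimeStable (f : F → F) : Prop :=
  -- every initial state admits a solution for all forward times
  (∀ ζ₀ : F, ∃ ζ : ℝ → F, ζ 0 = ζ₀ ∧ IsSolutionOn f ζ (Set.Ici 0)) ∧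
  ∃ β : ℝ → ℝ → ℝ, IsGenKL β ∧
  ∃ T : F → ℝ, Continuous T ∧ (∀ ζ₀, 0 ≤ T ζ₀) ∧
    (∀ (ζ : ℝ → F) (τ : ℝ), 0 < τ → IsSolutionOn f ζ (Set.Ico 0 τ) →
      ∀ t ∈ Set.Ico 0 τ, ‖ζ t‖ ≤ β ‖ζ 0‖ t) ∧
    (∀ (ζ₀ : F) (t : ℝ), T ζ₀ ≤ t → β ‖ζ₀‖ t = 0) ∧
    ∃ Tstar : ℝ, 0 < Tstar ∧ ∀ ζ₀, T ζ₀ ≤ Tstar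

end Stability

section System

variable {N : ℕ}

/-- The smallest eigenvalue of a symmetric matrix. -/
def minEigenvalue {Q : Matrix (Fin N) (Fin N) ℝ} (hQ : Q.IsHermitian) : ℝ :=
  ⨅ i, hQ.eigenvalues i

/-- The largest singular value of a matrix. -/
def maxSingularValue (M : Matrix (Fin N) (Fin N) ℝ) : ℝ :=
  (Matrix.toEuclideanLin M).singularValues 0

/-- The vector `v / |v| ^ ξ`, for `ξ < 1` extended continuously by `0` at `v = 0`. -/
def powNormalize (ξ : ℝ) (v : EuclideanSpace ℝ (Fin N)) : EuclideanSpace ℝ (Fin N) :=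
  (‖v‖ ^ ξ)⁻¹ • v

/-- The quadratic cost `φ(x) = ½ xᵀ Q x + bᵀ x + c`. -/
def quadraticCost (Q : Matrix (Fin N) (Fin N) ℝ) (b : EuclideanSpace ℝ (Fin N)) (c : ℝ)
    (x : EuclideanSpace ℝ (Fin N)) : ℝ :=
  1 / 2 * inner ℝ x (Matrix.toEuclideanLin Q x) + inner ℝ b x + c

/-- The feedback `u = u₁ + u₂` with `u₁ = -B⁻¹ A x` and
`u₂ = B⁻¹ (-ν (z - x) / |z - x| ^ ξ₁ - ν (z - x) / |z - x| ^ ξ₂)`. -/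
def feedback (A B : Matrix (Fin N) (Fin N) ℝ) (ν ξ₁ ξ₂ : ℝ) (x z : EuclideanSpace ℝ (Fin N)) :
    EuclideanSpace ℝ (Fin N) :=
  -Matrix.toEuclideanLin B⁻¹ (Matrix.toEuclideanLin A x) +
    Matrix.toEuclideanLin B⁻¹
      (-(ν • powNormalize ξ₁ (z - x)) - ν • powNormalize ξ₂ (z - x))

/-- The closed-loop vector field on the state space `ℝᴺ × ℝᴺ` (with its Euclidean norm), with
state `(x, z)`:
`x' = -k (∇φ(z) / |∇φ(z)| ^ ξ₁ + ∇φ(z) / |∇φ(z)| ^ ξ₂)` and `ε z' = A z + B u`. -/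
def closedLoop (φ : EuclideanSpace ℝ (Fin N) → ℝ) (A B : Matrix (Fin N) (Fin N) ℝ)
    (k ν ξ₁ ξ₂ ε : ℝ) (ζ : WithLp 2 (EuclideanSpace ℝ (Fin N) × EuclideanSpace ℝ (Fin N))) :
    WithLp 2 (EuclideanSpace ℝ (Fin N) × EuclideanSpace ℝ (Fin N)) :=
  WithLp.toLp 2
    (-(k • (powNormalize ξ₁ (gradient φ ζ.snd) + powNormalize ξ₂ (gradient φ ζ.snd))),
      (1 / ε) • (Matrix.toEuclideanLin A ζ.snd +
        Matrix.toEuclideanLin B (feedback A B ν ξ₁ ξ₂ ζ.fst ζ.snd)))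

end System

end

end FixedTime

/-! Centre the coordinates at the minimizer and put `y = z - x`, `g = Q z`. The feedback turns the
fast dynamics into `A y` minus the two power terms in `y`, all scaled by `1 / ε`, and the energy `U
= ½ ⟨x, Q x⟩ + ½ ⟨y, Q y⟩` is a strict Lyapunov function for small `ε`. Along the flow the slow part
supplies `-k (|g|^(2-ξ₁) + |g|^(2-ξ₂))`, because `Q x = g - Q y`. The fast part supplies `-(1/ε)(ν λ
- σ)(|y|^(2-ξ₁) + |y|^(2-ξ₂))`, where the gain condition is exactly `σ < ν λ`. The remaining
coupling, `2k ⟨Q y, ·⟩` against the normalized gradients, splits by Young's inequality into half of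
the slow dissipation and powers of `|y|`, which the factor `1/ε` absorbs (`exists_dissipation`).
Since `U` is at most a constant times `max |g| |y| ^ 2`, this gives `U' ≤ -c (U^(1-a) + U^(1+a))`
for some `a > 0` (`exists_energy_le_max_sq`, `rpow_energy_le`). Then `U^a / (1 + U^a)`, which lies
in `[0, 1)`, decreases at speed at least `a c / 2` while `U > 0`, so `U` vanishes by time `2 / (a
c)` whatever the initial state (`lyapunov_le_decay`). The field is continuous but need not be
Lipschitz at the origin, so existence comes from Peano's theorem, localized by the Lyapunov function
and continued by zero after extinction. -/

open Set Filter Topology MeasureTheory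

namespace FixedTime

/-! ### Peano existence by delayed approximations -/

section Peano

variable {F : Type*} [NormedAddCommGroup F] [NormedSpace ℝ F]

/-- The delayed Picard operator `y ↦ x₀ + ∫₀ᵗ f (y (s - h)) ds`, constant for `t ≤ 0`. -/
noncomputable def delayPicard (f : F → F) (x₀ : F) (h : ℝ) (y : ℝ → F) (t : ℝ) : F :=
  x₀ + ∫ s in (0 : ℝ)..max t 0, f (y (s - h))

theorem delayPicard_lipschitz [CompleteSpace F] {f : F → F} (hf : Continuous f) {M : NNReal}
    (hM : ∀ x, ‖f x‖ ≤ M) (x₀ : F) (h : ℝ) {y : ℝ → F} (hy : Continuous y) :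
    LipschitzWith M (delayPicard f x₀ h y) := by
  refine LipschitzWith.of_dist_le_mul fun s t => ?_
  have hc : Continuous fun s => f (y (s - h)) :=
    hf.comp (hy.comp (continuous_id.sub continuous_const))
  rw [dist_eq_norm, delayPicard, delayPicard, add_sub_add_left_eq_sub,
    intervalIntegral.integral_interval_sub_left (hc.intervalIntegrable _ _)
      (hc.intervalIntegrable _ _)]
  refine (intervalIntegral.norm_integral_le_of_norm_le_const fun r _ => hM _).trans ?_
  gcongr
  rw [Real.dist_eq]
  exact abs_max_sub_max_le_abs _ _ _

/-- With a delay `h`, the value at `t` depends only on values up to `t - h`. Each Picard iteration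
therefore fixes the curve on one more interval of length `h`, and finitely many iterations solve the
equation exactly on `[0, T]`. -/
theorem exists_delayed_solution [CompleteSpace F] {f : F → F} (hf : Continuous f) {M : NNReal}
    (hM : ∀ x, ‖f x‖ ≤ M) (x₀ : F) {h : ℝ} (hh : 0 < h) (T : ℝ) :
    ∃ y : ℝ → F, LipschitzWith M y ∧ ∀ t ∈ Icc 0 T, y t = x₀ + ∫ s in (0 : ℝ)..t, f (y (s - h)) := by
  let Y : ℕ → ℝ → F := fun m => (delayPicard f x₀ h)^[m] fun _ => x₀
  have hsucc : ∀ m, Y (m + 1) = delayPicard f x₀ h (Y m) := fun m =>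
    Function.iterate_succ_apply' _ _ _
  have hlip : ∀ m, LipschitzWith M (Y m) := by
    intro m
    induction m with
    | zero => exact (LipschitzWith.const x₀).weaken zero_le
    | succ m ih => rw [hsucc]; exact delayPicard_lipschitz hf hM x₀ h ih.continuous
  have hag : ∀ m : ℕ, ∀ t ≤ m * h, Y (m + 1) t = Y m t := by
    intro m
    induction m with
    | zero =>
      intro t ht
      have : max t 0 = 0 := max_eq_right (by simpa using ht)
      simp [Y, delayPicard, this]
    | succ m ih =>
      intro t ht
      rw [hsucc (m + 1)]
      conv_rhs => rw [hsucc m]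
      simp only [delayPicard]
      congr 1
      refine intervalIntegral.integral_congr fun s hs => ?_
      rw [uIcc_of_le (le_max_right _ _)] at hs
      have h1 : max t 0 ≤ (m + 1 : ℕ) * h := max_le ht (by positivity)
      have h2 : s - h ≤ m * h := by
        have := hs.2.trans h1
        push_cast at this
        linarith
      simp only [ih _ h2]
  obtain ⟨m, hm⟩ := exists_nat_ge (T / h)
  refine ⟨Y m, hlip m, fun t ht => ?_⟩
  have h1 : t ≤ m * h := ht.2.trans ((div_le_iff₀ hh).1 hm)
  rw [← hag m t h1, hsucc]
  simp only [delayPicard, max_eq_left ht.1]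

/-- **Peano existence theorem** for a bounded continuous vector field. -/
theorem exists_hasDerivAt_of_bounded [FiniteDimensional ℝ F] {f : F → F} (hf : Continuous f)
    {M : NNReal} (hM : ∀ x, ‖f x‖ ≤ M) (x₀ : F) {T : ℝ} (hT : 0 ≤ T) :
    ∃ x : ℝ → F, x 0 = x₀ ∧ ∀ t ∈ Icc 0 T, HasDerivAt x (f (x t)) t := by
  have : CompleteSpace F := FiniteDimensional.complete ℝ F
  have : ProperSpace F := FiniteDimensional.proper ℝ F
  let h : ℕ → ℝ := fun n => 1 / ((n : ℝ) + 1)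
  have hh : ∀ n, 0 < h n := fun n => by positivity
  have hh0 : Tendsto h atTop (𝓝 0) := tendsto_one_div_add_atTop_nhds_zero_nat
  choose Y hlip hY using fun n => exists_delayed_solution hf hM x₀ (hh n) T
  have hY0 : ∀ n, Y n 0 = x₀ := fun n => by simpa using hY n 0 ⟨le_rfl, hT⟩
  let u : ℕ → BoundedContinuousFunction (Icc 0 T) F := fun n =>
    BoundedContinuousFunction.mkOfCompact
      ⟨fun t => Y n t, (hlip n).continuous.comp continuous_subtype_val⟩
  have hcomp : IsCompact (closure (range u)) := by
    refine BoundedContinuousFunction.arzela_ascoli (Metric.closedBall x₀ (M * T))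
      (isCompact_closedBall _ _) _ ?_ ?_
    · rintro _ t ⟨n, rfl⟩
      have := (hlip n).dist_le_mul t 0
      rw [hY0, Real.dist_eq, sub_zero, abs_of_nonneg t.2.1] at this
      exact this.trans (mul_le_mul_of_nonneg_left t.2.2 M.2)
    · refine LipschitzWith.uniformEquicontinuous _ M (fun g => ?_) |>.equicontinuous
      obtain ⟨_, n, rfl⟩ := g
      exact ((hlip n).comp (LipschitzWith.subtype_val (Icc 0 T))).weaken (by simp)
  obtain ⟨v, -, φ, hφ, hv⟩ := hcomp.tendsto_subseq (x := u) fun n => subset_closure ⟨n, rfl⟩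
  let x : ℝ → F := IccExtend hT v
  have hxc : Continuous x := v.continuous.Icc_extend'
  have hptw : ∀ t ∈ Icc 0 T, Tendsto (fun n => Y (φ n) t) atTop (𝓝 (x t)) := by
    intro t ht
    have := (BoundedContinuousFunction.tendsto_iff_tendstoUniformly.1 hv).tendsto_at ⟨t, ht⟩
    rw [show x t = v ⟨t, ht⟩ from IccExtend_of_mem _ _ ht]
    exact this
  -- The common Lipschitz constant `M` makes the vanishing delay harmless: it moves the value by at
  -- most `M * h`.
  have hdel : ∀ t ∈ Icc 0 T, Tendsto (fun n => Y (φ n) (t - h (φ n))) atTop (𝓝 (x t)) := by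
    intro t ht
    refine tendsto_iff_dist_tendsto_zero.2 ?_
    have h1 := (tendsto_iff_dist_tendsto_zero.1 (hptw t ht))
    have h2 : Tendsto (fun n => (M : ℝ) * h (φ n) + dist (Y (φ n) t) (x t)) atTop (𝓝 0) := by
      simpa using ((hh0.comp hφ.tendsto_atTop).const_mul (M : ℝ)).add h1
    refine squeeze_zero (fun _ => dist_nonneg) (fun n => ?_) h2
    refine (dist_triangle _ (Y (φ n) t) _).trans ?_
    gcongr
    refine ((hlip _).dist_le_mul _ _).trans_eq ?_
    rw [Real.dist_eq, sub_sub_cancel_left, abs_neg, abs_of_pos (hh _)]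
  have hint : ∀ t ∈ Icc 0 T, x t = x₀ + ∫ s in (0 : ℝ)..t, f (x s) := by
    intro t ht
    refine tendsto_nhds_unique (hptw t ht) ?_
    simp only [fun n => hY (φ n) t ht]
    refine tendsto_const_nhds.add ?_
    refine intervalIntegral.tendsto_integral_filter_of_dominated_convergence (fun _ => (M : ℝ))
      (Eventually.of_forall fun n => ?_) (Eventually.of_forall fun n => ?_)
      intervalIntegrable_const ?_
    · exact (hf.comp ((hlip _).continuous.comp
        (continuous_id.sub continuous_const))).aestronglyMeasurable
    · exact Eventually.of_forall fun s _ => hM _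
    · refine Eventually.of_forall fun s hs => ?_
      rw [uIoc_of_le ht.1] at hs
      exact (hf.tendsto _).comp (hdel s ⟨hs.1.le, hs.2.trans ht.2⟩)
  -- The witness is the integral rather than `x`: the constant extension `x` need not be
  -- differentiable at `0` and `T`, whereas the integral has two-sided derivatives there.
  refine ⟨fun t => x₀ + ∫ s in (0 : ℝ)..t, f (x s), by simp, fun t ht => ?_⟩
  beta_reduce
  rw [← hint t ht]
  exact (intervalIntegral.integral_hasDerivAt_right ((hf.comp hxc).intervalIntegrable _ _)
    ((hf.comp hxc).stronglyMeasurableAtFilter _ _) (hf.comp hxc).continuousAt).const_add x₀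

end Peano

/-! ### Scalar comparison flow and its generalized class `𝒦ℒ` bound -/

/-- The increasing bijection `u ↦ uᵃ / (1 + uᵃ)` of `[0, ∞)` onto `[0, 1)`. -/
noncomputable def squash (a u : ℝ) : ℝ := u ^ a / (1 + u ^ a)

/-- The inverse of `squash a`. -/
noncomputable def unsquash (a w : ℝ) : ℝ := (w / (1 - w)) ^ (1 / a)

theorem squash_nonneg (a : ℝ) {u : ℝ} (hu : 0 ≤ u) : 0 ≤ squash a u := by
  have := Real.rpow_nonneg hu a
  unfold squash; positivity

theorem squash_lt_one (a : ℝ) {u : ℝ} (hu : 0 ≤ u) : squash a u < 1 := by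
  have := Real.rpow_nonneg hu a
  rw [squash, div_lt_one (by positivity)]
  linarith

theorem squash_zero {a : ℝ} (ha : 0 < a) : squash a 0 = 0 := by
  simp [squash, Real.zero_rpow ha.ne']

theorem squash_strictMonoOn {a : ℝ} (ha : 0 < a) : StrictMonoOn (squash a) (Ici 0) := by
  intro u hu v _ huv
  have h1 := Real.rpow_nonneg hu a
  have h2 := Real.rpow_lt_rpow hu huv ha
  rw [squash, squash, div_lt_div_iff₀ (by positivity) (by linarith)]
  nlinarith

theorem continuousOn_squash {a : ℝ} (ha : 0 < a) : ContinuousOn (squash a) (Ici 0) := by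
  have h : ContinuousOn (fun u : ℝ => u ^ a) (Ici 0) :=
    (Real.continuous_rpow_const ha.le).continuousOn
  refine h.div (continuousOn_const.add h) fun u hu => ?_
  have := Real.rpow_nonneg hu a
  positivity

theorem unsquash_squash {a : ℝ} (ha : 0 < a) {u : ℝ} (hu : 0 ≤ u) :
    unsquash a (squash a u) = u := by
  have h := Real.rpow_nonneg hu a
  have : squash a u / (1 - squash a u) = u ^ a := by
    unfold squash
    field_simp
    ring
  rw [unsquash, this, ← Real.rpow_mul hu, mul_one_div_cancel ha.ne', Real.rpow_one]

theorem unsquash_zero {a : ℝ} (ha : 0 < a) : unsquash a 0 = 0 := by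
  simp [unsquash, Real.zero_rpow (inv_ne_zero ha.ne')]

theorem unsquash_strictMonoOn {a : ℝ} (ha : 0 < a) : StrictMonoOn (unsquash a) (Ico 0 1) := by
  intro u hu v hv huv
  refine Real.rpow_lt_rpow (div_nonneg hu.1 (by linarith [hu.2])) ?_ (by positivity)
  rw [div_lt_div_iff₀ (by linarith [hu.2]) (by linarith [hv.2])]
  nlinarith [hu.1]

theorem unsquash_nonneg (a : ℝ) {w : ℝ} (hw : w ∈ Ico (0 : ℝ) 1) : 0 ≤ unsquash a w :=
  Real.rpow_nonneg (div_nonneg hw.1 (by linarith [hw.2])) _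

theorem continuousOn_unsquash {a : ℝ} (ha : 0 < a) : ContinuousOn (unsquash a) (Ico 0 1) := by
  refine ContinuousOn.rpow_const (continuousOn_id.div (continuousOn_const.sub continuousOn_id)
    fun u hu => ?_) fun _ _ => Or.inr (by positivity)
  exact (sub_pos.2 hu.2).ne'

theorem tendsto_squash_atTop {a : ℝ} (ha : 0 < a) : Tendsto (squash a) atTop (𝓝 1) := by
  have h : Tendsto (fun u : ℝ => 1 - (1 + u ^ a)⁻¹) atTop (𝓝 (1 - 0)) :=
    tendsto_const_nhds.sub
      (tendsto_inv_atTop_zero.comp (tendsto_atTop_add_const_left _ _ (tendsto_rpow_atTop ha)))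
  rw [sub_zero] at h
  refine h.congr' ?_
  filter_upwards [eventually_ge_atTop 0] with u hu
  have := Real.rpow_nonneg hu a
  unfold squash
  field_simp
  ring

/-- The value at time `t` of the scalar comparison flow started at `u`: along it, `squash a`
decreases at constant speed `κ` until it vanishes. -/
noncomputable def decay (a κ u t : ℝ) : ℝ := unsquash a (max (squash a u - κ * t) 0)

section Decay

variable {a κ : ℝ}

theorem max_squash_mem (hκ : 0 < κ) {u t : ℝ} (hu : 0 ≤ u) (ht : 0 ≤ t) :
    max (squash a u - κ * t) 0 ∈ Ico (0 : ℝ) 1 :=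
  ⟨le_max_right _ _, max_lt (by nlinarith [squash_lt_one a hu, mul_nonneg hκ.le ht]) one_pos⟩

theorem decay_nonneg (hκ : 0 < κ) {u t : ℝ} (hu : 0 ≤ u) (ht : 0 ≤ t) : 0 ≤ decay a κ u t :=
  unsquash_nonneg a (max_squash_mem hκ hu ht)

theorem decay_eq_zero (ha : 0 < a) {u t : ℝ} (h : squash a u ≤ κ * t) : decay a κ u t = 0 := by
  rw [decay, max_eq_right (by linarith), unsquash_zero ha]

theorem decay_mono_left (ha : 0 < a) (hκ : 0 < κ) {t : ℝ} (ht : 0 ≤ t) :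
    MonotoneOn (fun u => decay a κ u t) (Ici 0) := fun _ hu _ hv huv =>
  (unsquash_strictMonoOn ha).monotoneOn (max_squash_mem hκ hu ht) (max_squash_mem hκ hv ht)
    (max_le_max_right _ (sub_le_sub_right ((squash_strictMonoOn ha).monotoneOn hu hv huv) _))

theorem decay_antitone (ha : 0 < a) (hκ : 0 < κ) {u : ℝ} (hu : 0 ≤ u) :
    AntitoneOn (decay a κ u) (Ici 0) := fun s hs t ht hst =>
  (unsquash_strictMonoOn ha).monotoneOn (max_squash_mem hκ hu ht) (max_squash_mem hκ hu hs)
    (max_le_max_right _ (by nlinarith))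

theorem continuousOn_decay (ha : 0 < a) (hκ : 0 < κ) {t : ℝ} (ht : 0 ≤ t) :
    ContinuousOn (fun u => decay a κ u t) (Ici 0) :=
  (continuousOn_unsquash ha).comp
    (((continuousOn_squash ha).sub continuousOn_const).sup continuousOn_const)
    fun _ hu => max_squash_mem hκ hu ht

theorem exists_decay_pos (ha : 0 < a) (hκ : 0 < κ) {t : ℝ} (ht : 0 ≤ t) (h : κ * t < 1) :
    ∃ u, 0 ≤ u ∧ 0 < decay a κ u t := by
  obtain ⟨u, hu, hu0⟩ := (((tendsto_squash_atTop ha).eventually_const_lt h).and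
    (eventually_ge_atTop 0)).exists
  refine ⟨u, hu0, ?_⟩
  have h1 : max (squash a u - κ * t) 0 = squash a u - κ * t := max_eq_left (sub_pos.2 hu).le
  have h2 : squash a u - κ * t < 1 := by nlinarith [squash_lt_one a hu0, mul_nonneg hκ.le ht]
  rw [decay, h1]
  exact Real.rpow_pos_of_pos (div_pos (sub_pos.2 hu) (sub_pos.2 h2)) _

end Decay

/-- The `𝒦ℒ` bound attached to a quadratically bounded Lyapunov function whose evolution is
dominated by `decay a κ`. -/
noncomputable def decayBound (a κ a₁ a₂ r t : ℝ) : ℝ :=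
  (1 + r) * √(decay a κ (a₂ * r ^ 2) t / a₁)

/-- For fixed `t > 0` the comparison flow stays bounded as its initial value grows, so the square
root alone is not unbounded in `r`. The factor `1 + r` restores unboundedness, and also yields
strict growth from mere monotonicity of the root. -/
theorem isGenKL_decayBound {a κ a₁ a₂ : ℝ} (ha : 0 < a) (hκ : 0 < κ) (h₁ : 0 < a₁) (h₂ : 0 < a₂) :
    IsGenKL (decayBound a κ a₁ a₂) where
  genKInfty t ht := by
    have hmono : MonotoneOn (fun r => √(decay a κ (a₂ * r ^ 2) t / a₁)) (Ici 0) := by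
      intro r hr s hs hrs
      have hr' : 0 ≤ r := hr
      have := decay_mono_left ha hκ ht (a := a) (κ := κ) (t := t)
        (show a₂ * r ^ 2 ∈ Ici (0 : ℝ) from by simp; positivity)
        (show a₂ * s ^ 2 ∈ Ici (0 : ℝ) from by simp; positivity) (by gcongr)
      beta_reduce at this ⊢
      gcongr
    refine ⟨?_, ?_, ?_, ?_, ?_⟩
    · refine (continuousOn_const.add continuousOn_id).mul (ContinuousOn.sqrt (ContinuousOn.div_const
        ((continuousOn_decay ha hκ ht).comp (by fun_prop) fun r _ => ?_) _))
      exact mul_nonneg h₂.le (sq_nonneg r)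
    · have : decay a κ 0 t = 0 := decay_eq_zero ha (by rw [squash_zero ha]; positivity)
      simp [decayBound, this]
    · intro r hr s hs hrs
      have hr' : 0 ≤ r := hr
      exact mul_le_mul (by linarith) (hmono hr hs hrs) (Real.sqrt_nonneg _) (by linarith)
    · intro r s hr hrs hs
      have hs0 : 0 ≤ s := hr.trans hrs.le
      have : 0 < decay a κ (a₂ * s ^ 2) t := by
        by_contra! h
        rw [decayBound, Real.sqrt_eq_zero_of_nonpos (div_nonpos_of_nonpos_of_nonneg h h₁.le)] at hs
        simp at hs
      have h3 := hmono hr hs0 hrs.le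
      have h4 : 0 < √(decay a κ (a₂ * s ^ 2) t / a₁) := Real.sqrt_pos.2 (by positivity)
      simp only [decayBound] at *
      nlinarith
    -- Before time `1 / κ` some initial value survives, and its positive value times `1 + r` is a
    -- divergent minorant. From `1 / κ` on, every initial value has been extinguished.
    · by_cases h : κ * t < 1
      · right
        obtain ⟨u, hu, hpos⟩ := exists_decay_pos ha hκ ht h
        have h4 : 0 < √(decay a κ u t / a₁) := Real.sqrt_pos.2 (by positivity)
        refine tendsto_atTop_mono' atTop (f₁ := fun r => (1 + r) * √(decay a κ u t / a₁)) ?_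
          ((tendsto_atTop_add_const_left _ _ tendsto_id).atTop_mul_const h4)
        have hq : Tendsto (fun r : ℝ => a₂ * r ^ 2) atTop atTop :=
          (tendsto_pow_atTop two_ne_zero).const_mul_atTop h₂
        filter_upwards [hq.eventually_ge_atTop u, eventually_ge_atTop 0] with r hr hr0
        have := decay_mono_left ha hκ ht (a := a) (κ := κ) (t := t) hu
          (show a₂ * r ^ 2 ∈ Ici (0 : ℝ) from hu.trans hr) hr
        beta_reduce at this
        unfold decayBound
        gcongr
      · left
        intro r hr
        have : decay a κ (a₂ * r ^ 2) t = 0 :=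
          decay_eq_zero ha ((squash_lt_one a (by positivity)).le.trans (not_lt.1 h))
        simp [decayBound, this]
  antitoneOn r hr := by
    intro s hs t ht hst
    have := decay_antitone ha hκ (show 0 ≤ a₂ * r ^ 2 by positivity) hs ht hst
    unfold decayBound
    gcongr
  tendsto_zero r hr := by
    refine tendsto_const_nhds.congr' ?_
    filter_upwards [eventually_ge_atTop (1 / κ)] with t ht
    have h1 : 1 ≤ κ * t := by rwa [div_le_iff₀' hκ] at ht
    have : decay a κ (a₂ * r ^ 2) t = 0 :=
      decay_eq_zero ha ((squash_lt_one a (by positivity)).le.trans h1)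
    simp [decayBound, this]

/-! ### Lyapunov criterion for fixed-time stability -/

section Lyapunov

variable {F : Type*} [NormedAddCommGroup F] [NormedSpace ℝ F]

/-- Fixed-time decay of a Lyapunov function along a solution. -/
theorem lyapunov_le_decay {f : F → F} {U : F → ℝ} {U' : F → F →L[ℝ] ℝ}
    (hU : ∀ ζ, HasFDerivAt U (U' ζ) ζ) (hU0 : ∀ ζ, 0 ≤ U ζ) {a c : ℝ} (ha : 0 < a) (hc : 0 < c)
    (hdec : ∀ ζ, 0 < U ζ → U' ζ (f ζ) ≤ -c * (U ζ ^ (1 - a) + U ζ ^ (1 + a)))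
    (hdec₀ : ∀ ζ, U' ζ (f ζ) ≤ 0) {ζ : ℝ → F} {τ : ℝ} (hζ : IsSolutionOn f ζ (Ico 0 τ)) {t : ℝ}
    (ht : t ∈ Ico 0 τ) : U (ζ t) ≤ decay a (a * c / 2) (U (ζ 0)) t := by
  have hκ : 0 < a * c / 2 := by positivity
  have hsub : Icc 0 t ⊆ Ico 0 τ := fun s hs => ⟨hs.1, hs.2.trans_lt ht.2⟩
  have hd : ∀ s ∈ Icc 0 t, HasDerivWithinAt (fun s => U (ζ s)) (U' (ζ s) (f (ζ s))) (Icc 0 t) s :=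
    fun s hs => (hU _).comp_hasDerivWithinAt s ((hζ s (hsub hs)).mono hsub)
  have hcont : ContinuousOn (fun s => U (ζ s)) (Icc 0 t) := fun s hs => (hd s hs).continuousWithinAt
  have hanti : AntitoneOn (fun s => U (ζ s)) (Icc 0 t) := by
    refine antitoneOn_of_hasDerivWithinAt_nonpos (convex_Icc _ _) hcont
      (f' := fun s => U' (ζ s) (f (ζ s)))
      (fun s hs => (hd s (interior_subset hs)).mono interior_subset) fun s _ => hdec₀ _
  -- If `U` is positive at `t`, monotonicity makes it positive on all of `[0, t]`, where `U ^ a` is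
  -- differentiable even for `a < 1`.
  rcases (hU0 (ζ t)).eq_or_lt with h0 | hpos
  · rw [← h0]; exact decay_nonneg hκ (hU0 _) ht.1
  have hposs : ∀ s ∈ Icc 0 t, 0 < U (ζ s) := fun s hs =>
    hpos.trans_le (hanti hs ⟨ht.1, le_rfl⟩ hs.2)
  have hsq : ∀ s ∈ Icc 0 t, HasDerivWithinAt (fun s => squash a (U (ζ s)) + a * c / 2 * s)
      (a * U (ζ s) ^ (a - 1) * U' (ζ s) (f (ζ s)) / (1 + U (ζ s) ^ a) ^ 2 + a * c / 2)
      (Icc 0 t) s := by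
    intro s hs
    have hp := Real.rpow_pos_of_pos (hposs s hs) a
    have h1 := (hd s hs).rpow_const (p := a) (Or.inl (hposs s hs).ne')
    have h2 := (h1.div (h1.const_add 1) (by positivity)).add
      ((hasDerivWithinAt_id s _).const_mul (a * c / 2))
    refine h2.congr_deriv ?_
    field_simp
    ring
  have hanti2 : AntitoneOn (fun s => squash a (U (ζ s)) + a * c / 2 * s) (Icc 0 t) := by
    refine antitoneOn_of_hasDerivWithinAt_nonpos (convex_Icc _ _)
      (fun s hs => (hsq s hs).continuousWithinAt)
      (fun s hs => (hsq s (interior_subset hs)).mono interior_subset) fun s hs => ?_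
    have hs' := hposs s (interior_subset hs)
    have hp := Real.rpow_pos_of_pos hs' a
    have h1 := hdec _ hs'
    have e1 : U (ζ s) ^ (a - 1) * U (ζ s) ^ (1 - a) = 1 := by
      rw [← Real.rpow_add hs']; simp
    have e2 : U (ζ s) ^ (a - 1) * U (ζ s) ^ (1 + a) = (U (ζ s) ^ a) ^ 2 := by
      rw [← Real.rpow_add hs', ← Real.rpow_natCast, ← Real.rpow_mul hs'.le]; ring_nf
    have hq := Real.rpow_pos_of_pos hs' (a - 1)
    have h3 : a * U (ζ s) ^ (a - 1) * U' (ζ s) (f (ζ s)) ≤ -(a * c) * (1 + (U (ζ s) ^ a) ^ 2) := by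
      refine (mul_le_mul_of_nonneg_left h1 (by positivity)).trans_eq ?_
      linear_combination (-(a * c)) * e1 - (a * c) * e2
    -- With `w = U ^ a`, this is `(1 + w) ^ 2 ≤ 2 (1 + w ^ 2)`, the source of the factor `1 / 2` in
    -- the speed.
    have h4 : a * U (ζ s) ^ (a - 1) * U' (ζ s) (f (ζ s)) / (1 + U (ζ s) ^ a) ^ 2 ≤ -(a * c / 2) := by
      rw [div_le_iff₀ (by positivity)]
      refine h3.trans ?_
      nlinarith [mul_nonneg (mul_pos ha hc).le (sq_nonneg (1 - U (ζ s) ^ a))]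
    linarith
  have h5 := hanti2 ⟨le_rfl, ht.1⟩ ⟨ht.1, le_rfl⟩ ht.1
  simp only [mul_zero, add_zero] at h5
  have h6 : squash a (U (ζ t)) ≤ max (squash a (U (ζ 0)) - a * c / 2 * t) 0 :=
    le_max_of_le_left (by linarith)
  rw [← unsquash_squash ha (hU0 (ζ t))]
  exact (unsquash_strictMonoOn ha).monotoneOn ⟨squash_nonneg a (hU0 _), squash_lt_one a (hU0 _)⟩
    (max_squash_mem hκ (hU0 _) ht.1) h6

/-- A continuous vector field with a proper Lyapunov function has solutions on every bounded
interval. -/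
theorem exists_isSolutionOn_of_lyapunov [FiniteDimensional ℝ F] {f : F → F} (hf : Continuous f)
    {U : F → ℝ} {U' : F → F →L[ℝ] ℝ} (hU : ∀ ζ, HasFDerivAt U (U' ζ) ζ) {a₁ : ℝ} (h₁ : 0 < a₁)
    (hlow : ∀ ζ, a₁ * ‖ζ‖ ^ 2 ≤ U ζ) (hdec : ∀ ζ, U' ζ (f ζ) ≤ 0) (ζ₀ : F) {T : ℝ} (hT : 0 ≤ T) :
    ∃ ζ : ℝ → F, ζ 0 = ζ₀ ∧ ∀ t ∈ Icc 0 T, HasDerivAt ζ (f (ζ t)) t := by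
  have : ProperSpace F := FiniteDimensional.proper ℝ F
  let R := √(U ζ₀ / a₁)
  -- The cutoff makes the field bounded. It only rescales the derivative of `U` by a nonnegative
  -- factor, so `U` still decreases and the solution stays in the ball of radius `R`, where `χ = 1`.
  let χ : F → ℝ := fun ζ => max 0 (min 1 (R + 1 - ‖ζ‖))
  have hχ0 : ∀ ζ, 0 ≤ χ ζ := fun ζ => le_max_left _ _
  have hχ1 : ∀ ζ, χ ζ ≤ 1 := fun ζ => max_le zero_le_one (min_le_left _ _)
  have hχ : Continuous χ := by fun_prop
  obtain ⟨M, hM⟩ :=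
    (isCompact_closedBall (0 : F) (R + 1)).exists_bound_of_continuousOn hf.continuousOn
  obtain ⟨ζ, hζ0, hζ⟩ :=
    exists_hasDerivAt_of_bounded (f := fun v => χ v • f v) (hχ.smul hf) (M := M.toNNReal) (fun v => by
    by_cases hv : ‖v‖ ≤ R + 1
    · rw [norm_smul, Real.norm_of_nonneg (hχ0 v)]
      refine (mul_le_of_le_one_left (norm_nonneg _) (hχ1 v)).trans ((hM v (by simpa using hv)).trans ?_)
      exact Real.le_coe_toNNReal M
    · have : χ v = 0 := max_eq_left ((min_le_right _ _).trans (by linarith))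
      simp [this]) ζ₀ hT
  refine ⟨ζ, hζ0, fun t ht => ?_⟩
  have hd : ∀ s ∈ Icc 0 T, HasDerivAt (fun s => U (ζ s)) (χ (ζ s) * U' (ζ s) (f (ζ s))) s := by
    intro s hs
    exact ((hU _).comp_hasDerivAt s (hζ s hs)).congr_deriv (by simp)
  have hanti : AntitoneOn (fun s => U (ζ s)) (Icc 0 T) :=
    antitoneOn_of_hasDerivWithinAt_nonpos (convex_Icc _ _)
      (fun s hs => (hd s hs).continuousAt.continuousWithinAt)
      (fun s hs => (hd s (interior_subset hs)).hasDerivWithinAt)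
      fun s _ => mul_nonpos_of_nonneg_of_nonpos (hχ0 _) (hdec _)
  have h2 : U (ζ t) ≤ U ζ₀ := by
    simpa [hζ0] using hanti ⟨le_rfl, hT⟩ ht ht.1
  have h3 : ‖ζ t‖ ≤ R := by
    refine Real.le_sqrt_of_sq_le ?_
    rw [le_div_iff₀' h₁]
    exact (hlow _).trans h2
  have h4 : χ (ζ t) = 1 := by
    simp only [χ]
    rw [min_eq_left (by linarith)]
    simp
  simpa [h4] using hζ t ht

/-- Lyapunov criterion for global fixed-time stability. -/
theorem globallyFixedTimeStable_of_lyapunov [FiniteDimensional ℝ F] {f : F → F}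
    (hf : Continuous f) (hf0 : f 0 = 0) {U : F → ℝ} {U' : F → F →L[ℝ] ℝ}
    (hU : ∀ ζ, HasFDerivAt U (U' ζ) ζ) {a₁ a₂ : ℝ} (h₁ : 0 < a₁) (h₂ : 0 < a₂)
    (hlow : ∀ ζ, a₁ * ‖ζ‖ ^ 2 ≤ U ζ) (hupp : ∀ ζ, U ζ ≤ a₂ * ‖ζ‖ ^ 2) {a c : ℝ} (ha : 0 < a)
    (hc : 0 < c) (hdec : ∀ ζ, ζ ≠ 0 → U' ζ (f ζ) ≤ -c * (U ζ ^ (1 - a) + U ζ ^ (1 + a))) :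
    GloballyFixedTimeStable f := by
  have hU0 : ∀ ζ, 0 ≤ U ζ := fun ζ => (by positivity : 0 ≤ a₁ * ‖ζ‖ ^ 2).trans (hlow ζ)
  have hdec₀ : ∀ ζ, U' ζ (f ζ) ≤ 0 := by
    intro ζ
    by_cases h : ζ = 0
    · simp [h, hf0]
    · refine (hdec ζ h).trans (mul_nonpos_of_nonpos_of_nonneg (by linarith) ?_)
      exact add_nonneg (Real.rpow_nonneg (hU0 _) _) (Real.rpow_nonneg (hU0 _) _)
  have hdec₁ : ∀ ζ, 0 < U ζ → U' ζ (f ζ) ≤ -c * (U ζ ^ (1 - a) + U ζ ^ (1 + a)) := by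
    intro ζ h
    refine hdec ζ fun h0 => ?_
    have := hupp ζ
    simp [h0] at this
    rw [h0] at h
    linarith
  let κ := a * c / 2
  have hκ : 0 < κ := by positivity
  have hest : ∀ (ζ : ℝ → F) (τ : ℝ), IsSolutionOn f ζ (Ico 0 τ) →
      ∀ t ∈ Ico 0 τ, ‖ζ t‖ ≤ decayBound a κ a₁ a₂ ‖ζ 0‖ t := by
    intro ζ τ hζ t ht
    have h3 := lyapunov_le_decay hU hU0 ha hc hdec₁ hdec₀ hζ ht
    have h4 := decay_mono_left ha hκ ht.1 (hU0 (ζ 0))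
      (show a₂ * ‖ζ 0‖ ^ 2 ∈ Ici (0 : ℝ) from (hU0 _).trans (hupp _)) (hupp (ζ 0))
    have h5 : ‖ζ t‖ ≤ √(decay a κ (a₂ * ‖ζ 0‖ ^ 2) t / a₁) := by
      refine Real.le_sqrt_of_sq_le ?_
      rw [le_div_iff₀' h₁]
      exact (hlow _).trans (h3.trans h4)
    exact h5.trans (le_mul_of_one_le_left (Real.sqrt_nonneg _) (by linarith [norm_nonneg (ζ 0)]))
  have hzero : ∀ (r t : ℝ), squash a (a₂ * r ^ 2) / κ ≤ t → decayBound a κ a₁ a₂ r t = 0 := by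
    intro r t h
    rw [div_le_iff₀' hκ] at h
    simp [decayBound, decay_eq_zero ha h]
  have hsq1 : ∀ r : ℝ, squash a (a₂ * r ^ 2) / κ ≤ 1 / κ := fun r =>
    div_le_div_of_nonneg_right (squash_lt_one a (by positivity)).le hκ.le
  refine ⟨fun ζ₀ => ?_, decayBound a κ a₁ a₂, isGenKL_decayBound ha hκ h₁ h₂,
    fun ζ₀ => squash a (a₂ * ‖ζ₀‖ ^ 2) / κ, ?_, fun ζ₀ => ?_, fun ζ τ _ hζ => hest ζ τ hζ,
    fun ζ₀ t => hzero _ t, 1 / κ, by positivity, fun ζ₀ => hsq1 _⟩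
  · obtain ⟨ζ, hζ0, hζ⟩ := exists_isSolutionOn_of_lyapunov hf hU h₁ hlow hdec₀ ζ₀
      (T := 1 / κ + 1) (by positivity)
    have hsol : IsSolutionOn f ζ (Ico 0 (1 / κ + 1)) := fun t ht =>
      (hζ t (Ico_subset_Icc_self ht)).hasDerivWithinAt
    have hvan : ∀ t ∈ Ico (1 / κ) (1 / κ + 1), ζ t = 0 := by
      intro t ht
      have h3 := hest ζ _ hsol t ⟨le_trans (by positivity) ht.1, ht.2⟩
      rw [hzero _ t ((hsq1 _).trans ht.1)] at h3
      simpa using h3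
    -- The solution already vanishes on a unit interval before the switch to `0`, so the glued curve
    -- is differentiable at the junction.
    let η : ℝ → F := fun t => if t < 1 / κ + 1 then ζ t else 0
    have hκ' : 0 < 1 / κ := by positivity
    refine ⟨η, by simp [η, hζ0, show (0 : ℝ) < κ⁻¹ + 1 by positivity], fun t ht => ?_⟩
    refine HasDerivAt.hasDerivWithinAt ?_
    rcases lt_or_ge t (1 / κ + 1) with h | h
    · have : η =ᶠ[𝓝 t] ζ := by
        filter_upwards [eventually_lt_nhds h] with s hs
        simp only [η, if_pos hs]
      rw [this.eq_of_nhds]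
      exact (hζ t ⟨ht, h.le⟩).congr_of_eventuallyEq this
    · have : η =ᶠ[𝓝 t] fun _ => 0 := by
        filter_upwards [eventually_gt_nhds (show 1 / κ < t by linarith)] with s hs
        by_cases hs' : s < 1 / κ + 1
        · simp only [η, if_pos hs', hvan s ⟨hs.le, hs'⟩]
        · simp only [η, if_neg hs']
      rw [this.eq_of_nhds, hf0]
      exact (hasDerivAt_const t (0 : F)).congr_of_eventuallyEq this
  · exact ((continuousOn_squash ha).comp_continuous (by fun_prop)
      fun ζ₀ => mul_nonneg h₂.le (sq_nonneg _)).div_const _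
  · exact div_nonneg (squash_nonneg a (by positivity)) hκ.le

end Lyapunov

/-! ### Eigenvalue and singular value bounds -/

section Spectral

variable {E : Type*} [NormedAddCommGroup E] [InnerProductSpace ℝ E]

theorem inner_apply_eq_sum_of_eigenbasis {ι : Type*} [Fintype ι] {T : E →ₗ[ℝ] E}
    (hT : T.IsSymmetric) (e : OrthonormalBasis ι ℝ E) {μ : ι → ℝ} (he : ∀ i, T (e i) = μ i • e i)
    (v : E) : inner ℝ v (T v) = ∑ i, μ i * inner ℝ (e i) v ^ 2 := by
  rw [← e.sum_inner_mul_inner v (T v)]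
  refine Finset.sum_congr rfl fun i _ => ?_
  rw [← hT, he, real_inner_smul_left, real_inner_comm]
  ring

theorem norm_sq_eq_sum_inner_sq {ι : Type*} [Fintype ι] (e : OrthonormalBasis ι ℝ E) (v : E) :
    ‖v‖ ^ 2 = ∑ i, inner ℝ (e i) v ^ 2 := by
  rw [← real_inner_self_eq_norm_sq, ← e.sum_inner_mul_inner v v]
  refine Finset.sum_congr rfl fun i _ => ?_
  rw [real_inner_comm, sq]

/-- Expand `⟨v, T* T v⟩` in an eigenbasis of `T* T`: its eigenvalues are the squared singular
values, and the one with index `0` is the largest. -/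
theorem norm_apply_le_singularValues_zero [FiniteDimensional ℝ E] (T : E →ₗ[ℝ] E) (v : E) :
    ‖T v‖ ≤ T.singularValues 0 * ‖v‖ := by
  refine le_of_sq_le_sq ?_ (mul_nonneg (T.singularValues_nonneg 0) (norm_nonneg v))
  have hs := T.isSymmetric_adjoint_comp_self
  have h1 : ‖T v‖ ^ 2 = inner ℝ v ((T.adjoint ∘ₗ T) v) := by
    rw [LinearMap.comp_apply, LinearMap.adjoint_inner_right, real_inner_self_eq_norm_sq]
  rw [h1, inner_apply_eq_sum_of_eigenbasis hs (hs.eigenvectorBasis rfl)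
    (μ := hs.eigenvalues rfl) (fun i => hs.apply_eigenvectorBasis rfl i), mul_pow,
    norm_sq_eq_sum_inner_sq (hs.eigenvectorBasis rfl), Finset.mul_sum]
  refine Finset.sum_le_sum fun i _ => ?_
  rw [← T.sq_singularValues_fin rfl i]
  have := T.singularValues_antitone (Nat.zero_le i)
  have := T.singularValues_nonneg i
  gcongr

end Spectral

section Matrix

variable {N : ℕ} {Q : Matrix (Fin N) (Fin N) ℝ}

theorem minEigenvalue_mul_norm_sq_le (hQ : Q.IsHermitian) (v : EuclideanSpace ℝ (Fin N)) :
    minEigenvalue hQ * ‖v‖ ^ 2 ≤ inner ℝ v (Matrix.toEuclideanLin Q v) := by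
  rw [inner_apply_eq_sum_of_eigenbasis (Matrix.isSymmetric_toEuclideanLin_iff.2 hQ)
    hQ.eigenvectorBasis (μ := hQ.eigenvalues) (fun i => ?_),
    norm_sq_eq_sum_inner_sq hQ.eigenvectorBasis, Finset.mul_sum]
  · refine Finset.sum_le_sum fun i _ => ?_
    have : minEigenvalue hQ ≤ hQ.eigenvalues i := ciInf_le (Set.finite_range _).bddBelow i
    gcongr
  · ext j
    simpa using congrFun (hQ.mulVec_eigenvectorBasis i) j

theorem minEigenvalue_pos [NeZero N] (hQ : Q.PosDef) : 0 < minEigenvalue hQ.isHermitian := by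
  obtain ⟨i, hi⟩ := exists_eq_ciInf_of_finite (f := hQ.isHermitian.eigenvalues)
  rw [minEigenvalue, ← hi]
  exact hQ.eigenvalues_pos i

end Matrix

/-! ### Gradient of the quadratic cost -/

section Quadratic

variable {E : Type*} [NormedAddCommGroup E] [InnerProductSpace ℝ E]

theorem hasFDerivAt_half_inner_apply {L : E →L[ℝ] E} (hL : (L : E →ₗ[ℝ] E).IsSymmetric) (v : E) :
    HasFDerivAt (fun v => 1 / 2 * inner ℝ v (L v)) (innerSL ℝ (L v)) v := by
  refine (((hasFDerivAt_id v).inner ℝ (L.hasFDerivAt (x := v))).const_mul (1 / 2)).congr_fderiv ?_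
  ext w
  have : inner ℝ v (L w) = inner ℝ (L v) w := (hL v w).symm
  simp [this, real_inner_comm w]
  ring

theorem gradient_quadraticCost {N : ℕ} {Q : Matrix (Fin N) (Fin N) ℝ} (hQ : Q.IsHermitian)
    (b : EuclideanSpace ℝ (Fin N)) (c : ℝ) (z : EuclideanSpace ℝ (Fin N)) :
    gradient (quadraticCost Q b c) z = Matrix.toEuclideanLin Q z + b := by
  refine HasGradientAt.gradient (hasGradientAt_iff_hasFDerivAt.2 ?_)
  have h := hasFDerivAt_half_inner_apply (L := (Matrix.toEuclideanLin Q).toContinuousLinearMap)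
    (Matrix.isSymmetric_toEuclideanLin_iff.2 hQ) z
  refine ((h.add (innerSL ℝ b).hasFDerivAt).add_const c).congr_fderiv ?_
  ext w
  simp

theorem gradient_quadraticCost_add_minimizer {N : ℕ} {Q : Matrix (Fin N) (Fin N) ℝ}
    (hQ : Q.IsHermitian) {b : EuclideanSpace ℝ (Fin N)} {c : ℝ} {xs : EuclideanSpace ℝ (Fin N)}
    (hxs : IsMinOn (quadraticCost Q b c) Set.univ xs) (z : EuclideanSpace ℝ (Fin N)) :
    gradient (quadraticCost Q b c) (z + xs) = Matrix.toEuclideanLin Q z := by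
  have h : gradient (quadraticCost Q b c) xs = 0 := by
    rw [gradient, (hxs.isLocalMin univ_mem).fderiv_eq_zero, map_zero]
  rw [gradient_quadraticCost hQ] at h ⊢
  rw [map_add, add_assoc, h, add_zero]

end Quadratic

/-! ### The normalized vector `v / |v| ^ ξ` -/

section PowNormalize

variable {N : ℕ} {ξ : ℝ}

theorem norm_powNormalize (hξ : ξ < 1) (v : EuclideanSpace ℝ (Fin N)) :
    ‖powNormalize ξ v‖ = ‖v‖ ^ (1 - ξ) := by
  rcases eq_or_ne v 0 with rfl | hv
  · simp [powNormalize, Real.zero_rpow (sub_pos.2 hξ).ne']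
  · have hv' := norm_pos_iff.2 hv
    rw [powNormalize, norm_smul, Real.norm_of_nonneg (by positivity), Real.rpow_sub hv',
      Real.rpow_one]
    field_simp

theorem continuous_powNormalize (hξ : ξ < 1) :
    Continuous (powNormalize ξ : EuclideanSpace ℝ (Fin N) → EuclideanSpace ℝ (Fin N)) := by
  refine continuous_iff_continuousAt.2 fun v => ?_
  rcases eq_or_ne v 0 with rfl | hv
  · have h0 : powNormalize ξ (0 : EuclideanSpace ℝ (Fin N)) = 0 := by simp [powNormalize]
    rw [ContinuousAt, h0, tendsto_zero_iff_norm_tendsto_zero]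
    simp only [norm_powNormalize hξ]
    have : ContinuousAt (fun v : EuclideanSpace ℝ (Fin N) => ‖v‖ ^ (1 - ξ)) 0 :=
      continuous_norm.continuousAt.rpow_const (Or.inr (sub_pos.2 hξ).le)
    simpa [ContinuousAt, Real.zero_rpow (sub_pos.2 hξ).ne'] using this
  · have hv' := norm_pos_iff.2 hv
    exact ((continuous_norm.continuousAt.rpow_const (Or.inl hv'.ne')).inv₀
      (Real.rpow_pos_of_pos hv' ξ).ne').smul continuousAt_id

theorem le_inner_powNormalize (hξ : ξ < 1) {v w : EuclideanSpace ℝ (Fin N)} {lam : ℝ}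
    (h : lam * ‖v‖ ^ 2 ≤ inner ℝ w v) :
    lam * ‖v‖ ^ (2 - ξ) ≤ inner ℝ w (powNormalize ξ v) := by
  rcases eq_or_ne v 0 with rfl | hv
  · simp [powNormalize, Real.zero_rpow (by linarith : (2 : ℝ) - ξ ≠ 0)]
  · have hv' := norm_pos_iff.2 hv
    rw [powNormalize, real_inner_smul_right, Real.rpow_sub hv', Real.rpow_two]
    have := mul_le_mul_of_nonneg_left h (inv_nonneg.2 (Real.rpow_nonneg hv'.le ξ))
    refine le_of_eq_of_le ?_ this
    ring

theorem inner_powNormalize_le (hξ : ξ < 1) (v w : EuclideanSpace ℝ (Fin N)) :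
    inner ℝ w (powNormalize ξ v) ≤ ‖w‖ * ‖v‖ ^ (1 - ξ) :=
  (real_inner_le_norm _ _).trans_eq (by rw [norm_powNormalize hξ])

end PowNormalize

/-! ### Scalar power inequalities -/

theorem rpow_le_rpow_add_rpow {s p q r : ℝ} (hs : 0 ≤ s) (hp : 0 ≤ p) (hpq : p ≤ q) (hqr : q ≤ r) :
    s ^ q ≤ s ^ p + s ^ r := by
  have h1 := Real.rpow_nonneg hs p
  have h2 := Real.rpow_nonneg hs r
  rcases le_total s 1 with h | h
  · linarith [Real.rpow_le_rpow_of_exponent_ge' hs h hp hpq]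
  · linarith [Real.rpow_le_rpow_of_exponent_le h hqr]

/-- A Young inequality with a crude constant. If `K s ≤ g / 2`, the first term on the right
suffices; otherwise `g ≤ 2 K s`, and the second does. -/
theorem mul_mul_rpow_sub_one_le {K s g r : ℝ} (hK : 0 ≤ K) (hs : 0 ≤ s) (hg : 0 ≤ g) (hr : 1 < r) :
    K * s * g ^ (r - 1) ≤ 1 / 2 * g ^ r + 1 / 2 * (2 * K) ^ r * s ^ r := by
  have split : ∀ x : ℝ, 0 ≤ x → x ^ r = x * x ^ (r - 1) := fun x hx => by
    rw [← Real.rpow_one_add' hx (by linarith), add_sub_cancel]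
  have h1 : 0 ≤ g ^ r := Real.rpow_nonneg hg r
  have h2 : 0 ≤ (2 * K) ^ r * s ^ r := by positivity
  rcases le_total (K * s) (g / 2) with h | h
  · have := mul_le_mul_of_nonneg_right h (Real.rpow_nonneg hg (r - 1))
    rw [split g hg] at h1 ⊢
    linarith
  · have h3 : g ^ (r - 1) ≤ (2 * K * s) ^ (r - 1) :=
      Real.rpow_le_rpow hg (by linarith) (by linarith)
    have h4 := mul_le_mul_of_nonneg_left h3 (mul_nonneg hK hs)
    have h5 : (2 * K) ^ r * s ^ r = 2 * K * s * (2 * K * s) ^ (r - 1) := by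
      rw [← Real.mul_rpow (by positivity) hs, split _ (by positivity)]
    linarith

/-! ### Dissipation of the interconnection -/

section Dissipation

variable {N : ℕ} {L A : EuclideanSpace ℝ (Fin N) →L[ℝ] EuclideanSpace ℝ (Fin N)}

/-- Decay of the `L`-quadratic form along the boundary layer dynamics. -/
theorem inner_boundaryLayer_le {lam σ ν ξ₁ ξ₂ : ℝ} (hσ : 0 ≤ σ) (hν : 0 ≤ ν)
    (hξ₁ : ξ₁ ∈ Ioo (0 : ℝ) 1) (hξ₂ : ξ₂ < 0) (hL : ∀ v, lam * ‖v‖ ^ 2 ≤ inner ℝ (L v) v)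
    (hA : ∀ v, inner ℝ (L v) (A v) ≤ σ * ‖v‖ ^ 2) (y : EuclideanSpace ℝ (Fin N)) :
    inner ℝ (L y) (A y - ν • powNormalize ξ₁ y - ν • powNormalize ξ₂ y) ≤
      -(ν * lam - σ) * (‖y‖ ^ (2 - ξ₁) + ‖y‖ ^ (2 - ξ₂)) := by
  rw [inner_sub_right, inner_sub_right, real_inner_smul_right, real_inner_smul_right]
  have h1 := mul_le_mul_of_nonneg_left (le_inner_powNormalize hξ₁.2 (hL y)) hν
  have h2 := mul_le_mul_of_nonneg_left (le_inner_powNormalize (by linarith : ξ₂ < 1) (hL y)) hν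
  have h3 : ‖y‖ ^ 2 ≤ ‖y‖ ^ (2 - ξ₁) + ‖y‖ ^ (2 - ξ₂) := by
    rw [← Real.rpow_two]
    exact rpow_le_rpow_add_rpow (norm_nonneg y) (by linarith [hξ₁.2]) (by linarith [hξ₁.1])
      (by linarith)
  have h4 := mul_le_mul_of_nonneg_left h3 hσ
  linarith [hA y]

/-- The coupling term of the interconnection, for one of the two powers. -/
theorem inner_coupling_le {k ξ : ℝ} (hk : 0 ≤ k) (hξ : ξ < 1) (y g : EuclideanSpace ℝ (Fin N)) :
    2 * k * inner ℝ (L y) (powNormalize ξ g) ≤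
      k / 2 * ‖g‖ ^ (2 - ξ) + k / 2 * (4 * ‖L‖) ^ (2 - ξ) * ‖y‖ ^ (2 - ξ) := by
  have h1 := inner_powNormalize_le hξ g (L y)
  have h2 := mul_le_mul_of_nonneg_right (L.le_opNorm y) (Real.rpow_nonneg (norm_nonneg g) (1 - ξ))
  have h3 := mul_mul_rpow_sub_one_le (K := 2 * ‖L‖) (s := ‖y‖) (g := ‖g‖) (r := 2 - ξ)
    (by positivity) (norm_nonneg y) (norm_nonneg g) (by linarith)
  rw [show 2 - ξ - 1 = 1 - ξ by ring, show 2 * (2 * ‖L‖) = 4 * ‖L‖ by ring] at h3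
  have h4 := mul_le_mul_of_nonneg_left (h1.trans h2) (by positivity : 0 ≤ 2 * k)
  have h5 := mul_le_mul_of_nonneg_left h3 hk
  linarith

/-- Weighting both parts of the energy by the same `L` makes the two cross terms, one from `L x = L
z - L (z - x)` and one from the motion of `x` inside `z - x`, equal. Their sum costs half of the
dissipation in `L z`, plus `C₁` and `C₂` times powers of `‖z - x‖`. -/
theorem exists_dissipation {lam σ ν k ξ₁ ξ₂ : ℝ} (hσ : 0 ≤ σ) (hν : 0 ≤ ν) (hk : 0 < k)
    (hξ₁ : ξ₁ ∈ Ioo (0 : ℝ) 1) (hξ₂ : ξ₂ < 0) (hL : ∀ v, lam * ‖v‖ ^ 2 ≤ inner ℝ (L v) v)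
    (hA : ∀ v, inner ℝ (L v) (A v) ≤ σ * ‖v‖ ^ 2) (hgap : σ < ν * lam) :
    ∃ εstar : ℝ, 0 < εstar ∧ ∀ ε ∈ Ioo 0 εstar, ∀ x z : EuclideanSpace ℝ (Fin N),
      inner ℝ (L x) (-(k • (powNormalize ξ₁ (L z) + powNormalize ξ₂ (L z)))) +
        inner ℝ (L (z - x)) ((1 / ε) • (A (z - x) - ν • powNormalize ξ₁ (z - x) -
          ν • powNormalize ξ₂ (z - x)) + k • (powNormalize ξ₁ (L z) + powNormalize ξ₂ (L z))) ≤
      -(k / 2) * ((‖L z‖ ^ (2 - ξ₁) + ‖z - x‖ ^ (2 - ξ₁)) +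
        (‖L z‖ ^ (2 - ξ₂) + ‖z - x‖ ^ (2 - ξ₂))) := by
  set C₁ := k / 2 * (4 * ‖L‖) ^ (2 - ξ₁)
  set C₂ := k / 2 * (4 * ‖L‖) ^ (2 - ξ₂)
  have hC₁ : 0 ≤ C₁ := by positivity
  have hC₂ : 0 ≤ C₂ := by positivity
  have hδ : 0 < ν * lam - σ := sub_pos.2 hgap
  -- Below this threshold the fast dissipation rate `(ν * lam - σ) / ε` pays for both coupling
  -- constants and leaves `k / 2`.
  refine ⟨(ν * lam - σ) / (C₁ + C₂ + k / 2), by positivity, fun ε hε x z => ?_⟩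
  obtain ⟨y, rfl⟩ : ∃ y, z = x + y := ⟨z - x, by abel⟩
  rw [add_sub_cancel_left]
  have hLx : L x = L (x + y) - L y := by rw [map_add, add_sub_cancel_right]
  rw [hLx]
  generalize L (x + y) = g
  have e1 : inner ℝ (g - L y) (-(k • (powNormalize ξ₁ g + powNormalize ξ₂ g))) +
        inner ℝ (L y) ((1 / ε) • (A y - ν • powNormalize ξ₁ y - ν • powNormalize ξ₂ y) +
          k • (powNormalize ξ₁ g + powNormalize ξ₂ g)) =
      -k * inner ℝ g (powNormalize ξ₁ g) - k * inner ℝ g (powNormalize ξ₂ g) +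
      2 * k * inner ℝ (L y) (powNormalize ξ₁ g) + 2 * k * inner ℝ (L y) (powNormalize ξ₂ g) +
      1 / ε * inner ℝ (L y) (A y - ν • powNormalize ξ₁ y - ν • powNormalize ξ₂ y) := by
    simp only [inner_sub_left, inner_neg_right, inner_add_right, real_inner_smul_right]
    ring
  rw [e1]
  have hξ₂' : ξ₂ < 1 := by linarith
  have hgg : 1 * ‖g‖ ^ 2 ≤ inner ℝ g g := by rw [one_mul, real_inner_self_eq_norm_sq]
  have b1 := mul_le_mul_of_nonneg_left (le_inner_powNormalize hξ₁.2 hgg) hk.le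
  have b2 := mul_le_mul_of_nonneg_left (le_inner_powNormalize hξ₂' hgg) hk.le
  have c1 := inner_coupling_le (L := L) hk.le hξ₁.2 y g
  have c2 := inner_coupling_le (L := L) hk.le hξ₂' y g
  have d := mul_le_mul_of_nonneg_left (inner_boundaryLayer_le hσ hν hξ₁ hξ₂ hL hA y)
    (one_div_pos.2 hε.1).le
  have hbig : C₁ + C₂ + k / 2 ≤ 1 / ε * (ν * lam - σ) := by
    have h := (lt_div_iff₀ (by positivity)).1 hε.2
    rw [one_div_mul_eq_div, le_div_iff₀ hε.1]
    linarith
  have n1 : 0 ≤ ‖y‖ ^ (2 - ξ₁) := Real.rpow_nonneg (norm_nonneg y) _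
  have n2 : 0 ≤ ‖y‖ ^ (2 - ξ₂) := Real.rpow_nonneg (norm_nonneg y) _
  have f := mul_le_mul_of_nonneg_right hbig (add_nonneg n1 n2)
  have f1 := mul_nonneg hC₂ n1
  have f2 := mul_nonneg hC₁ n2
  change _ ≤ k / 2 * ‖g‖ ^ (2 - ξ₁) + C₁ * ‖y‖ ^ (2 - ξ₁) at c1
  change _ ≤ k / 2 * ‖g‖ ^ (2 - ξ₂) + C₂ * ‖y‖ ^ (2 - ξ₂) at c2
  nlinarith

end Dissipation

/-! ### The energy and its bounds -/

section LyapunovFunction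

variable {E : Type*} [NormedAddCommGroup E] [InnerProductSpace ℝ E]

/-- The Lyapunov function `½ ⟨x, L x⟩ + ½ ⟨z - x, L (z - x)⟩`. -/
noncomputable def energy (L : E →L[ℝ] E) (ζ : WithLp 2 (E × E)) : ℝ :=
  1 / 2 * inner ℝ ζ.fst (L ζ.fst) + 1 / 2 * inner ℝ (ζ.snd - ζ.fst) (L (ζ.snd - ζ.fst))

theorem hasFDerivAt_energy {L : E →L[ℝ] E} (hL : (L : E →ₗ[ℝ] E).IsSymmetric)
    (ζ : WithLp 2 (E × E)) :
    HasFDerivAt (energy L) (innerSL ℝ (L ζ.fst) ∘L WithLp.fstL 2 ℝ E E +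
      innerSL ℝ (L (ζ.snd - ζ.fst)) ∘L (WithLp.sndL 2 ℝ E E - WithLp.fstL 2 ℝ E E)) ζ := by
  have hy := (hasFDerivAt_half_inner_apply hL
    ((WithLp.sndL 2 ℝ E E - WithLp.fstL 2 ℝ E E) ζ)).comp ζ
    (WithLp.sndL 2 ℝ E E - WithLp.fstL 2 ℝ E E).hasFDerivAt
  exact ((hasFDerivAt_half_inner_apply hL ζ.fst).comp ζ (WithLp.fstL 2 ℝ E E).hasFDerivAt).add hy

theorem norm_sub_sq_le_two_mul (x z : E) : ‖z - x‖ ^ 2 ≤ 2 * (‖x‖ ^ 2 + ‖z‖ ^ 2) := by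
  have := parallelogram_law_with_norm ℝ z x
  nlinarith [sq_nonneg ‖z + x‖]

/-- With `y = z - x`, `|z|² ≤ 2 (|x|² + |y|²)` gives `|x|² + |z|² ≤ 3 (|x|² + |y|²)`. Together with
the `½` in the energy this produces the `6`. -/
theorem energy_ge {L : E →L[ℝ] E} {lam : ℝ} (hlam : 0 ≤ lam)
    (hpos : ∀ v, lam * ‖v‖ ^ 2 ≤ inner ℝ v (L v)) (ζ : WithLp 2 (E × E)) :
    lam / 6 * ‖ζ‖ ^ 2 ≤ energy L ζ := by
  have h1 := hpos ζ.fst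
  have h2 := hpos (ζ.snd - ζ.fst)
  have h3 := norm_sub_sq_le_two_mul (-ζ.fst) (ζ.snd - ζ.fst)
  rw [sub_neg_eq_add, sub_add_cancel, norm_neg] at h3
  have h4 := mul_le_mul_of_nonneg_left h3 hlam
  have h5 := mul_nonneg hlam (sq_nonneg ‖ζ.snd - ζ.fst‖)
  rw [WithLp.prod_norm_sq_eq_of_L2, energy]
  linarith

theorem energy_le (L : E →L[ℝ] E) (ζ : WithLp 2 (E × E)) :
    energy L ζ ≤ ‖L‖ / 2 * (‖ζ.fst‖ ^ 2 + ‖ζ.snd - ζ.fst‖ ^ 2) := by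
  have h : ∀ v : E, inner ℝ v (L v) ≤ ‖L‖ * ‖v‖ ^ 2 := fun v =>
    (real_inner_le_norm _ _).trans
      ((mul_le_mul_of_nonneg_left (L.le_opNorm v) (norm_nonneg v)).trans_eq (by ring))
  have h1 := h ζ.fst
  have h2 := h (ζ.snd - ζ.fst)
  rw [energy]
  linarith

theorem energy_le_norm_sq (L : E →L[ℝ] E) (ζ : WithLp 2 (E × E)) :
    energy L ζ ≤ (3 / 2 * ‖L‖ + 1) * ‖ζ‖ ^ 2 := by
  have h := norm_sub_sq_le_two_mul ζ.fst ζ.snd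
  refine (energy_le L ζ).trans ?_
  rw [WithLp.prod_norm_sq_eq_of_L2]
  nlinarith [mul_le_mul_of_nonneg_left h (norm_nonneg L),
    mul_nonneg (norm_nonneg L) (sq_nonneg ‖ζ.snd‖), sq_nonneg ‖ζ.snd‖, sq_nonneg ‖ζ.fst‖]

/-- The energy is controlled by the arguments of the two dissipation terms. -/
theorem exists_energy_le_max_sq {L : E →L[ℝ] E} {lam : ℝ} (hlam : 0 < lam)
    (hpos : ∀ v, lam * ‖v‖ ^ 2 ≤ inner ℝ v (L v)) :
    ∃ K : ℝ, 0 < K ∧ ∀ ζ : WithLp 2 (E × E),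
      energy L ζ ≤ K * max ‖L ζ.snd‖ ‖ζ.snd - ζ.fst‖ ^ 2 := by
  -- Coercivity gives `lam * |z| ≤ |L z|`, and `x = z - (z - x)` then has norm at most `(1 / lam +
  -- 1) * m`. The `+ 1` next to `‖L‖` only secures positivity.
  refine ⟨(‖L‖ + 1) / 2 * ((1 / lam + 1) ^ 2 + 1), by positivity, fun ζ => ?_⟩
  set m := max ‖L ζ.snd‖ ‖ζ.snd - ζ.fst‖
  have hy : ‖ζ.snd - ζ.fst‖ ≤ m := le_max_right _ _
  have hg : ‖L ζ.snd‖ ≤ m := le_max_left _ _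
  have hm : 0 ≤ m := (norm_nonneg _).trans hg
  have hz : ‖ζ.snd‖ ≤ 1 / lam * m := by
    rw [one_div_mul_eq_div, le_div_iff₀' hlam]
    rcases (norm_nonneg ζ.snd).eq_or_lt with h | h
    · rw [← h, mul_zero]; exact hm
    · refine le_of_mul_le_mul_right ?_ h
      have h1 := (hpos ζ.snd).trans (real_inner_le_norm _ _)
      nlinarith
  have hx : ‖ζ.fst‖ ≤ (1 / lam + 1) * m := by
    have : ‖ζ.fst‖ ≤ ‖ζ.snd‖ + ‖ζ.snd - ζ.fst‖ := by
      simpa using norm_sub_le ζ.snd (ζ.snd - ζ.fst)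
    linarith
  have hx2 : ‖ζ.fst‖ ^ 2 ≤ ((1 / lam + 1) * m) ^ 2 := by gcongr
  have hy2 : ‖ζ.snd - ζ.fst‖ ^ 2 ≤ m ^ 2 := by gcongr
  calc energy L ζ ≤ ‖L‖ / 2 * (‖ζ.fst‖ ^ 2 + ‖ζ.snd - ζ.fst‖ ^ 2) := energy_le L ζ
    _ ≤ (‖L‖ + 1) / 2 * (((1 / lam + 1) * m) ^ 2 + m ^ 2) := by gcongr; linarith
    _ = _ := by ring

end LyapunovFunction

/-- The powers `u ^ (1 ∓ a)` are of order `m ^ (2 ∓ 2a)`, and both exponents lie between `p` and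
`r`, so the sum of the extreme powers dominates each. -/
theorem rpow_energy_le {u K m a p r : ℝ} (hu : 0 ≤ u) (hK : 0 < K) (hm : 0 ≤ m)
    (h : u ≤ K * m ^ 2) (hp : 0 ≤ p) (ha : 0 ≤ a) (ha' : a ≤ 1) (hpa : p ≤ 2 - 2 * a)
    (har : 2 + 2 * a ≤ r) :
    u ^ (1 - a) + u ^ (1 + a) ≤ (K ^ (1 - a) + K ^ (1 + a)) * (m ^ p + m ^ r) := by
  have key : ∀ q, 0 ≤ q → p ≤ 2 * q → 2 * q ≤ r → u ^ q ≤ K ^ q * (m ^ p + m ^ r) := by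
    intro q hq h1 h2
    refine (Real.rpow_le_rpow hu h hq).trans ?_
    rw [Real.mul_rpow hK.le (sq_nonneg m), ← Real.rpow_two, ← Real.rpow_mul hm]
    exact mul_le_mul_of_nonneg_left (rpow_le_rpow_add_rpow hm hp h1 h2) (Real.rpow_nonneg hK.le q)
  rw [add_mul]
  exact add_le_add (key _ (by linarith) (by linarith) (by linarith))
    (key _ (by linarith) (by linarith) (by linarith))

theorem max_rpow_le_add {s t q : ℝ} (hs : 0 ≤ s) (ht : 0 ≤ t) : max s t ^ q ≤ s ^ q + t ^ q := by
  have h1 := Real.rpow_nonneg hs q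
  have h2 := Real.rpow_nonneg ht q
  rcases max_choice s t with h | h <;> rw [h] <;> linarith

/-! ### The closed loop in centred coordinates and the spectral gap -/

section System

variable {N : ℕ}

/-- The closed loop in coordinates centred at the equilibrium. -/
theorem closedLoop_add_minimizer {Q A B : Matrix (Fin N) (Fin N) ℝ} (hQ : Q.IsHermitian)
    (hB : IsUnit B.det) {b : EuclideanSpace ℝ (Fin N)} {c : ℝ} {xs : EuclideanSpace ℝ (Fin N)}
    (hxs : IsMinOn (quadraticCost Q b c) Set.univ xs) (k ν ξ₁ ξ₂ ε : ℝ)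
    (ζ : WithLp 2 (EuclideanSpace ℝ (Fin N) × EuclideanSpace ℝ (Fin N))) :
    closedLoop (quadraticCost Q b c) A B k ν ξ₁ ξ₂ ε (ζ + WithLp.toLp 2 (xs, xs)) =
      WithLp.toLp 2
        (-(k • (powNormalize ξ₁ (Matrix.toEuclideanLin Q ζ.snd) +
            powNormalize ξ₂ (Matrix.toEuclideanLin Q ζ.snd))),
          (1 / ε) • (Matrix.toEuclideanLin A (ζ.snd - ζ.fst) - ν • powNormalize ξ₁ (ζ.snd - ζ.fst) -
            ν • powNormalize ξ₂ (ζ.snd - ζ.fst))) := by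
  -- Once `B B⁻¹` cancels, `A z` and `-A x` combine to `A (z - x)`, in which the shift by `xs` drops
  -- out.
  have hBB : ∀ v, Matrix.toEuclideanLin B (Matrix.toEuclideanLin B⁻¹ v) = v := by
    intro v
    ext i
    simp [Matrix.toLpLin_apply, Matrix.mulVec_mulVec, Matrix.mul_nonsing_inv B hB]
  have h1 : (ζ + WithLp.toLp 2 (xs, xs)).fst = ζ.fst + xs := rfl
  have h2 : (ζ + WithLp.toLp 2 (xs, xs)).snd = ζ.snd + xs := rfl
  rw [closedLoop, h1, h2, gradient_quadraticCost_add_minimizer hQ hxs, feedback,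
    add_sub_add_right_eq_sub]
  simp only [map_add, map_neg, map_sub, hBB]
  congr 3
  abel

/-- Symmetry of `Q` turns `⟨Q v, A v⟩` into `⟨v, Q A v⟩`, which is why the singular value of `Q * A`
enters the gain condition. -/
theorem exists_eigenvalue_gap {Q A : Matrix (Fin N) (Fin N) ℝ} (hQ : Q.PosDef) {ν : ℝ}
    (hν : maxSingularValue (Q * A) / minEigenvalue hQ.isHermitian < ν) :
    ∃ lam σ : ℝ, 0 < lam ∧ 0 ≤ σ ∧ σ < ν * lam ∧
      (∀ v : EuclideanSpace ℝ (Fin N), lam * ‖v‖ ^ 2 ≤ inner ℝ v (Matrix.toEuclideanLin Q v)) ∧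
      ∀ v : EuclideanSpace ℝ (Fin N),
        inner ℝ (Matrix.toEuclideanLin Q v) (Matrix.toEuclideanLin A v) ≤ σ * ‖v‖ ^ 2 := by
  rcases Nat.eq_zero_or_pos N with rfl | hN
  -- In dimension zero the infimum over no eigenvalues is `0`, and division by `0` gives `0`. The
  -- hypothesis then reads `0 < ν`, and `lam = 1`, `σ = 0` serve.
  · refine ⟨1, 0, one_pos, le_rfl, ?_, fun v => ?_, fun v => ?_⟩
    · simpa [minEigenvalue] using hν
    · simp [Subsingleton.elim v 0]
    · simp [Subsingleton.elim v 0]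
  · have : NeZero N := ⟨hN.ne'⟩
    have hpos := minEigenvalue_pos hQ
    refine ⟨_, maxSingularValue (Q * A), hpos, LinearMap.singularValues_nonneg _ 0,
      (div_lt_iff₀ hpos).1 hν, minEigenvalue_mul_norm_sq_le hQ.isHermitian, fun v => ?_⟩
    have hQA : Matrix.toEuclideanLin Q (Matrix.toEuclideanLin A v) =
        Matrix.toEuclideanLin (Q * A) v := by
      ext i
      simp [Matrix.toLpLin_apply, Matrix.mulVec_mulVec]
    have hsym := Matrix.isSymmetric_toEuclideanLin_iff.2 hQ.isHermitian
    rw [hsym v, hQA]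
    refine (real_inner_le_norm _ _).trans ?_
    have := norm_apply_le_singularValues_zero (Matrix.toEuclideanLin (Q * A)) v
    exact (mul_le_mul_of_nonneg_left this (norm_nonneg v)).trans_eq (by rw [maxSingularValue]; ring)

end System

end FixedTime

/-! ### The main theorem -/

open FixedTime in
/-- The closed-loop system is written in coordinates centred at the equilibrium `(xs, xs)`, where
`xs` is the minimizer of the cost; if `b = 0` then `xs = 0` and this is the system itself. -/
theorem mainTheorem2 {N : ℕ} (Q A B : Matrix (Fin N) (Fin N) ℝ) (hQ : Q.PosDef)
    (hB : IsUnit B.det) (b : EuclideanSpace ℝ (Fin N)) (c : ℝ)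
    (xs : EuclideanSpace ℝ (Fin N))
    (hxs : IsMinOn (FixedTime.quadraticCost Q b c) Set.univ xs)
    (k ν ξ₁ ξ₂ : ℝ) (hk : 0 < k) (hξ₁ : ξ₁ ∈ Set.Ioo (0 : ℝ) 1) (hξ₂ : ξ₂ < 0)
    (hν : FixedTime.maxSingularValue (Q * A) / FixedTime.minEigenvalue hQ.isHermitian < ν) :
    ∃ εstar : ℝ, 0 < εstar ∧ ∀ ε ∈ Set.Ioo 0 εstar,
      FixedTime.GloballyFixedTimeStable fun ζ =>
        FixedTime.closedLoop (FixedTime.quadraticCost Q b c) A B k ν ξ₁ ξ₂ ε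
          (ζ + WithLp.toLp 2 (xs, xs)) := by
  obtain ⟨lam, σ, hlam, hσ, hgap, hpos, hA⟩ := exists_eigenvalue_gap (A := A) hQ hν
  have hν0 : 0 ≤ ν := (pos_of_mul_pos_left (hσ.trans_lt hgap) hlam.le).le
  have hξ₂' : ξ₂ < 1 := by linarith
  have hsym := Matrix.isSymmetric_toEuclideanLin_iff.2 hQ.isHermitian
  let L := (Matrix.toEuclideanLin Q).toContinuousLinearMap
  obtain ⟨εstar, hεstar, hdiss⟩ := exists_dissipation (L := L)
    (A := (Matrix.toEuclideanLin A).toContinuousLinearMap) hσ hν0 hk hξ₁ hξ₂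
    (fun v => (hpos v).trans_eq (real_inner_comm _ _)) hA hgap
  refine ⟨εstar, hεstar, fun ε hε => ?_⟩
  simp only [closedLoop_add_minimizer hQ.isHermitian hB hxs]
  obtain ⟨K, hK, hKle⟩ := exists_energy_le_max_sq (L := L) hlam hpos
  -- The largest `a` for which `2 - 2a` and `2 + 2a` both lie in `[2 - ξ₁, 2 - ξ₂]`, as
  -- `rpow_energy_le` requires.
  let a := min ξ₁ (-ξ₂) / 2
  have ha : 0 < a := half_pos (lt_min hξ₁.1 (by linarith))
  have ha₁ : 2 * a ≤ ξ₁ := by linarith [min_le_left ξ₁ (-ξ₂), show 2 * a = min ξ₁ (-ξ₂) by ring]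
  have ha₂ : 2 * a ≤ -ξ₂ := by linarith [min_le_right ξ₁ (-ξ₂), show 2 * a = min ξ₁ (-ξ₂) by ring]
  have hpow : 0 < K ^ (1 - a) + K ^ (1 + a) := by positivity
  have hc₁ := continuous_powNormalize (N := N) hξ₁.2
  have hc₂ := continuous_powNormalize (N := N) hξ₂'
  have hfst := (WithLp.fstL 2 ℝ (EuclideanSpace ℝ (Fin N)) (EuclideanSpace ℝ (Fin N))).continuous
  have hsnd := (WithLp.sndL 2 ℝ (EuclideanSpace ℝ (Fin N)) (EuclideanSpace ℝ (Fin N))).continuous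
  refine globallyFixedTimeStable_of_lyapunov ?_ ?_ (hasFDerivAt_energy (L := L) hsym)
    (a₁ := lam / 6) (a₂ := 3 / 2 * ‖L‖ + 1) (by positivity) (by positivity)
    (energy_ge hlam.le hpos) (energy_le_norm_sq L) ha
    (c := k / 2 / (K ^ (1 - a) + K ^ (1 + a))) (by positivity) fun ζ _ => ?_
  · have hg := (L.continuous.comp hsnd)
    have hy := hsnd.sub hfst
    exact (WithLp.prod_continuous_toLp 2 _ _).comp
      ((((hc₁.comp hg).add (hc₂.comp hg)).const_smul k).neg.prodMk
      (((((Matrix.toEuclideanLin A).toContinuousLinearMap.continuous.comp hy).sub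
        ((hc₁.comp hy).const_smul ν)).sub ((hc₂.comp hy).const_smul ν)).const_smul (1 / ε)))
  · simp [powNormalize]
  · set m := max ‖L ζ.snd‖ ‖ζ.snd - ζ.fst‖
    have hm : 0 ≤ m := (norm_nonneg _).trans (le_max_left _ _)
    have hU0 : 0 ≤ energy L ζ :=
      (by positivity : 0 ≤ lam / 6 * ‖ζ‖ ^ 2).trans (energy_ge hlam.le hpos ζ)
    have h1 := rpow_energy_le (a := a) (p := 2 - ξ₁) (r := 2 - ξ₂) hU0 hK hm (hKle ζ)
      (by linarith [hξ₁.2]) ha.le (by linarith [hξ₁.2]) (by linarith) (by linarith)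
    have h2 : m ^ (2 - ξ₁) + m ^ (2 - ξ₂) ≤ _ := add_le_add
      (max_rpow_le_add (norm_nonneg (L ζ.snd)) (norm_nonneg (ζ.snd - ζ.fst)))
      (max_rpow_le_add (norm_nonneg (L ζ.snd)) (norm_nonneg (ζ.snd - ζ.fst)))
    have h3 := hdiss ε hε ζ.fst ζ.snd
    have h4 : k / 2 / (K ^ (1 - a) + K ^ (1 + a)) *
        (energy L ζ ^ (1 - a) + energy L ζ ^ (1 + a)) ≤ k / 2 * (m ^ (2 - ξ₁) + m ^ (2 - ξ₂)) := by
      rw [div_mul_eq_mul_div, div_le_iff₀ hpow]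
      nlinarith [mul_le_mul_of_nonneg_left h1 (half_pos hk).le]
    have h5 := mul_le_mul_of_nonneg_left h2 (half_pos hk).le
    rw [neg_mul]
    refine le_trans (le_of_eq ?_) (h3.trans (by linarith))
    simp only [add_apply, ContinuousLinearMap.comp_apply,
      sub_apply, innerSL_apply_apply]
    congr 2
    exact sub_neg_eq_add _ _
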